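/- **Theorem 5.1 (Vanishing Theorem).** Let $\Lambda=\mathbb C[p_1,p_2,\dots]$ be the algebra of symmetric functions, and define its elements $h_k$ by $$H(u)=1+\sum_{k\ge1}\frac{h_k}{u^k}=\exp\Bigl(\sum_{k\ge1}\frac{p_k}{k\,u^k}\Bigr).$$ For finitely supported sequences $x=(x_1,x_2,\dots)$ and $y=(y_1,y_2,\dots)$ of complex numbers, let $f\mapsto f(x;y)$ be the algebra homomorphism $\Lambda\to\mathbb C$ with $p_k\mapsto\sum_i x_i^k+(-1)^{k-1}\sum_i y_i^k$ for all $k\ge1$. Let $a=(a_i)_{i\in\mathbb Z}$ be an arbitrary sequence of complex numbers. Write $(\tau^r a)_i=a_{i+r}$ for $r\in\mathbb Z$ and $\widehat a_i=-a_{-i+1}$. Define $h_{k;a}\in\Lambda$, $k\ge1$, by the identity of formal series in $u^{-1}$ $$1+\sum_{k\ge1}\frac{h_{k;a}}{(u-a_1)\cdots(u-a_k)}=H(u),$$ and put $h_{0;a}=1$ and $h_{k;a}=0$ for $k<0$. For a Young diagram $\mu$ with rows $\mu_1\ge\mu_2\ge\cdots$, let $$s_{\mu;a}=\det\bigl[h_{\mu_i-i+j;\,\tau^{1-j}a}\bigr]_{i,j=1}^{n}\in\Lambda,$$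 where $n$ is any integer not smaller than the number of nonzero rows of $\mu$ (the determinant does not depend on the choice of $n$). Let $\lambda$ be a Young diagram with conjugate $\lambda'$, let $D$ be the number of its diagonal squares, and let $P_i=\lambda_i-i$, $Q_i=\lambda'_i-i$ for $1\le i\le D$ be its Frobenius coordinates. Define sequences $x(\lambda)$ and $y(\lambda)$ by $$x(\lambda)_i=a_{P_i+1},\quad y(\lambda)_i=\widehat a_{Q_i+1}\quad(1\le i\le D),\qquad x(\lambda)_i=y(\lambda)_i=0\quad(i>D).$$ If $\mu$ and $\lambda$ are Young diagrams with $\mu\not\subseteq\lambda$, then $$s_{\mu;a}(x(\lambda);y(\lambda))=0.$$ -/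

import Mathlib

open scoped PowerSeries

noncomputable section

namespace MultiSchur

/-- The algebra `Λ = ℂ[p₁, p₂, …]` of symmetric functions over `ℂ`. The generator `p_k`
(`k ≥ 1`) is the variable `X (k - 1)`. -/
abbrev Sym : Type := MvPolynomial ℕ ℂ

/-- The value `p_{k+1}(x; y) = ∑ x_i^{k+1} + (-1)^k ∑ y_i^{k+1}` of the super power sum
`p_{k+1}` at finitely supported sequences `x`, `y`. -/
def superPowerSum (x y : ℕ →₀ ℂ) (k : ℕ) : ℂ :=
  (x.sum fun _ v => v ^ (k + 1)) + (-1) ^ k * (y.sum fun _ v => v ^ (k + 1))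

/-- The super realization `f ↦ f(x; y)`: the algebra homomorphism `Λ → ℂ` that sends every
generator `p_k` to the super power sum `p_k(x; y)`. Sequences are indexed from `0`. -/
def superEval (x y : ℕ →₀ ℂ) : Sym →ₐ[ℂ] ℂ :=
  MvPolynomial.aeval (superPowerSum x y)

/-- The series `∑_{k ≥ 1} p_k t^k / k`. -/
def powerSumSeries : Sym⟦X⟧ :=
  PowerSeries.mk fun n => if n = 0 then 0 else MvPolynomial.C (1 / (n : ℂ)) * MvPolynomial.X (n - 1)

/-- The generating series `H = exp (∑_{k ≥ 1} p_k t^k / k)` of the complete homogeneous symmetric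
functions, in the variable `t = 1/u`. -/
def completeSeries : Sym⟦X⟧ :=
  (PowerSeries.exp Sym).subst powerSumSeries

/-- The expansion of `1 / ((u - a_1) ⋯ (u - a_k))` as a power series in `t = 1/u`, that is
`t^k / ((1 - a_1 t) ⋯ (1 - a_k t))`. -/
def invFactorial (a : ℤ → ℂ) (k : ℕ) : ℂ⟦X⟧ :=
  PowerSeries.X ^ k *
    (∏ i ∈ Finset.range k, (1 - PowerSeries.C (a (i + 1)) * PowerSeries.X))⁻¹

/-- The multiparameter complete functions `h_{k;a}` for `k ≥ 0`, obtained by solving the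
triangular system `∑_k h_{k;a} / ((u - a_1) ⋯ (u - a_k)) = H(u)` for the coefficients. See
`complete_iff`: they are the unique solution. -/
def complete (a : ℤ → ℂ) (k : ℕ) : Sym :=
  PowerSeries.coeff k completeSeries -
    ∑ j : Fin k, PowerSeries.coeff k (invFactorial a j) • complete a j
termination_by k
decreasing_by exact j.isLt

/-- The functions `h_{k;a}` for all integers `k`, with `h_{k;a} = 0` for `k < 0`. -/
def completeInt (a : ℤ → ℂ) (k : ℤ) : Sym :=
  if k < 0 then 0 else complete a k.toNat

/-- The shift `(τ^r a)_i = a_{i+r}`. -/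
def shift (r : ℤ) (a : ℤ → ℂ) : ℤ → ℂ := fun i => a (i + r)

/-- The determinant `det [h_{μ_i - i + j; τ^{1-j} a}]` of order `n`. The indices `i`, `j` of `Fin n`
start at `0`, so that the shift `1 - j` becomes `-j`. -/
def schurDet (a : ℤ → ℂ) (μ : YoungDiagram) (n : ℕ) : Sym :=
  Matrix.det (Matrix.of fun i j : Fin n =>
    completeInt (shift (-(j : ℤ)) a) ((μ.rowLen i : ℤ) - (i : ℤ) + (j : ℤ)))

/-- The multiparameter Schur function `s_{μ;a}`: the determinant of order `ℓ(μ)`, the number of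
rows of `μ`. By `schurDet_eq` every larger order gives the same element. -/
def schur (a : ℤ → ℂ) (μ : YoungDiagram) : Sym := schurDet a μ (μ.colLen 0)

/-- The depth of a diagram, that is the number of its diagonal squares. -/
def depth (lam : YoungDiagram) : ℕ := (lam.cells.filter fun c => c.1 = c.2).card

/-- The Frobenius coordinate `P_{i+1} = λ_{i+1} - (i+1)`, for `i < depth lam`. -/
def frobeniusP (lam : YoungDiagram) (i : ℕ) : ℕ := lam.rowLen i - (i + 1)

/-- The Frobenius coordinate `Q_{i+1} = λ'_{i+1} - (i+1)`, for `i < depth lam`. -/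
def frobeniusQ (lam : YoungDiagram) (i : ℕ) : ℕ := lam.colLen i - (i + 1)

/-- The dual sequence `â_i = -a_{-i+1}`. -/
def dual (a : ℤ → ℂ) : ℤ → ℂ := fun i => -a (-i + 1)

/-- The sequence `x(λ)`: `x(λ)_i = a_{P_i + 1}` for `i ≤ depth`, and `0` afterwards. -/
def xSeq (a : ℤ → ℂ) (lam : YoungDiagram) : ℕ →₀ ℂ :=
  Finsupp.onFinset (Finset.range (depth lam))
    (fun i => if i < depth lam then a ((frobeniusP lam i : ℤ) + 1) else 0)
    (fun i h => by
      by_contra hi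
      exact h (if_neg (by simpa using hi)))

/-- The sequence `y(λ)`: `y(λ)_i = â_{Q_i + 1}` for `i ≤ depth`, and `0` afterwards. -/
def ySeq (a : ℤ → ℂ) (lam : YoungDiagram) : ℕ →₀ ℂ :=
  Finsupp.onFinset (Finset.range (depth lam))
    (fun i => if i < depth lam then dual a ((frobeniusQ lam i : ℤ) + 1) else 0)
    (fun i h => by
      by_contra hi
      exact h (if_neg (by simpa using hi)))

/-! Checks that the definitions are sound. -/

theorem hasSubst_powerSumSeries : PowerSeries.HasSubst powerSumSeries :=
  PowerSeries.HasSubst.of_constantCoeff_zero' (by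
    rw [← PowerSeries.coeff_zero_eq_constantCoeff_apply]
    simp [powerSumSeries])

theorem coeff_invFactorial_self (a : ℤ → ℂ) (k : ℕ) :
    PowerSeries.coeff k (invFactorial a k) = 1 := by
  have h := PowerSeries.coeff_X_pow_mul
    ((∏ i ∈ Finset.range k, (1 - PowerSeries.C (a (i + 1)) * PowerSeries.X))⁻¹ : ℂ⟦X⟧) k 0
  rw [zero_add] at h
  rw [invFactorial, h, PowerSeries.coeff_zero_eq_constantCoeff_apply,
    PowerSeries.constantCoeff_inv, map_prod]
  simp

theorem coeff_invFactorial_of_lt (a : ℤ → ℂ) {n k : ℕ} (h : n < k) :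
    PowerSeries.coeff n (invFactorial a k) = 0 := by
  rw [invFactorial, PowerSeries.coeff_X_pow_mul', if_neg (by omega)]

/-- The functions `h_{k;a}` are the unique solution of
`∑_{k ≥ 0} h_{k;a} / ((u - a_1) ⋯ (u - a_k)) = H(u)`, an equality of series in `1/u`, where the
terms with `k > n` do not contribute to the coefficient of `u^{-n}`. -/
theorem complete_iff (a : ℤ → ℂ) (h : ℕ → Sym) :
    (∀ n, ∑ k ∈ Finset.range (n + 1), PowerSeries.coeff n (invFactorial a k) • h k =
      PowerSeries.coeff n completeSeries) ↔ h = complete a := by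
  constructor
  · intro H
    funext n
    induction n using Nat.strong_induction_on with
    | _ n ih =>
      have h1 := H n
      rw [Finset.sum_range_succ, coeff_invFactorial_self, one_smul] at h1
      rw [complete, ← h1, Fin.sum_univ_eq_sum_range
        (fun j => PowerSeries.coeff n (invFactorial a j) • complete a j)]
      rw [Finset.sum_congr rfl fun k hk => by rw [ih k (Finset.mem_range.1 hk)]]
      ring
  · rintro rfl n
    rw [Finset.sum_range_succ, coeff_invFactorial_self, one_smul]
    conv_lhs => rw [complete, Fin.sum_univ_eq_sum_range
        (fun j => PowerSeries.coeff n (invFactorial a j) • complete a j)]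
    ring

theorem complete_zero (a : ℤ → ℂ) : complete a 0 = 1 := by
  rw [complete]
  simp only [Finset.univ_eq_empty, Finset.sum_empty, sub_zero, completeSeries]
  have h0 : PowerSeries.constantCoeff powerSumSeries = 0 := by
    rw [← PowerSeries.coeff_zero_eq_constantCoeff_apply]
    simp [powerSumSeries]
  rw [PowerSeries.coeff_zero_eq_constantCoeff_apply]
  change MvPowerSeries.constantCoeff _ = _
  rw [PowerSeries.constantCoeff_subst hasSubst_powerSumSeries, finsum_eq_single _ 0]
  · simp
  · intro d hd
    change _ • PowerSeries.constantCoeff _ = _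
    rw [map_pow, h0, zero_pow hd, smul_zero]

theorem schurDet_eq (a : ℤ → ℂ) (μ : YoungDiagram) {n : ℕ} (hn : μ.colLen 0 ≤ n) :
    schurDet a μ n = schur a μ := by
  induction n, hn using Nat.le_induction with
  | base => rfl
  | succ n hn ih =>
    have hrow : μ.rowLen n = 0 := by
      by_contra h
      have h1 : (n, 0) ∈ μ := YoungDiagram.mem_iff_lt_rowLen.2 (Nat.pos_of_ne_zero h)
      have h2 := YoungDiagram.mem_iff_lt_colLen.1 h1
      omega
    rw [← ih, schurDet, Matrix.det_succ_row _ (Fin.last n), Finset.sum_eq_single (Fin.last n)]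
    · simp [hrow, completeInt, complete_zero, schurDet, Matrix.submatrix, ← two_mul]
    · intro j _ hj
      have : (j : ℕ) < n := Fin.val_lt_last hj
      simp [hrow, completeInt, this]
    · simp

theorem lt_depth_iff (lam : YoungDiagram) (i : ℕ) : i < depth lam ↔ (i, i) ∈ lam := by
  have hcard : depth lam = ((lam.cells.filter fun c => c.1 = c.2).image Prod.fst).card := by
    rw [depth, Finset.card_image_of_injOn]
    rintro ⟨p, q⟩ hc ⟨p', q'⟩ hc' h
    simp_all
  have hmem : ∀ k, k ∈ (lam.cells.filter fun c => c.1 = c.2).image Prod.fst ↔ (k, k) ∈ lam := by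
    intro k
    simp
  rw [hcard]
  constructor
  · intro hi
    by_contra hn
    have hsub : (lam.cells.filter fun c => c.1 = c.2).image Prod.fst ⊆ Finset.range i := by
      intro k hk
      rw [hmem] at hk
      rw [Finset.mem_range]
      by_contra hki
      exact hn (lam.up_left_mem (not_lt.1 hki) (not_lt.1 hki) hk)
    have := Finset.card_le_card hsub
    rw [Finset.card_range] at this
    omega
  · intro hi
    have hsub : Finset.range (i + 1) ⊆ (lam.cells.filter fun c => c.1 = c.2).image Prod.fst := by
      intro k hk
      rw [hmem]
      have hk' : k ≤ i := by simpa [Nat.lt_succ_iff] using hk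
      exact lam.up_left_mem hk' hk' hi
    have := Finset.card_le_card hsub
    rw [Finset.card_range] at this
    omega

end MultiSchur

end

noncomputable section

namespace MultiSchur

/-! With t = 1/u, h_{k;a} is the coefficient of t^k in H · ∏_{1≤i<k} (1 - a_i t)
(`eq_coeff_mul_prod_lin`). Numbering rows from 0, at (x(λ); y(λ)) the series H becomes ∏_{i<n} (1 -
a_{-i} t) / (1 - a_{λ_i-i} t) for n ≥ ℓ(λ) (`superComplete_mul_prod_rows`). Put b_s = a_{s+1-n}, l_i
= λ_i+n-1-i, r_i = μ_i+n-1-i. Entry (i, j) of the determinant is then the coefficient of u⁻¹ in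
p_j(u) ∏_{s<r_i} (u - b_s) / ∏_{m<n} (u - b_{l_m}), where p_j = ∏_{n-j≤s<n} (u - b_s)
(`superEval_completeInt`). So row i is a linear functional on polynomials of degree < n: a divided
difference at the nodes b_{l_m}.

If λ_k < μ_k, then r_i > l_k ≥ l_m for i ≤ k ≤ m, so the numerator cancels the nodes from k on. The
k+1 functionals of the rows i ≤ k therefore kill every multiple of ∏_{m<k} (u - b_{l_m})
(`rowCoeff_mul_eq_zero`). They factor through a space of dimension k, hence are dependent
(`det_rowCoeff_eq_zero`). -/

/-- The linear factor `1 - c t` as a polynomial. -/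
def linPoly (c : ℂ) : Polynomial ℂ := 1 - Polynomial.C c * Polynomial.X

/-- The linear factor `1 - c t` as a power series. -/
def lin (c : ℂ) : ℂ⟦X⟧ := 1 - PowerSeries.C c * PowerSeries.X

theorem coe_linPoly (c : ℂ) : (linPoly c : ℂ⟦X⟧) = lin c := by
  simp [linPoly, lin]

theorem coe_prod_linPoly {ι : Type*} (s : Finset ι) (f : ι → ℂ) :
    ((∏ i ∈ s, linPoly (f i) : Polynomial ℂ) : ℂ⟦X⟧) = ∏ i ∈ s, lin (f i) := by
  rw [← Polynomial.coeToPowerSeries.ringHom_apply, map_prod]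
  simp [coe_linPoly]

theorem natDegree_linPoly_le (c : ℂ) : (linPoly c).natDegree ≤ 1 := by
  unfold linPoly
  compute_degree

theorem natDegree_prod_linPoly_le {ι : Type*} (s : Finset ι) (f : ι → ℂ) :
    (∏ i ∈ s, linPoly (f i)).natDegree ≤ s.card := by
  refine (Polynomial.natDegree_prod_le _ _).trans ?_
  simpa using Finset.sum_le_card_nsmul s _ 1 fun i _ => natDegree_linPoly_le (f i)

@[simp]
theorem constantCoeff_lin (c : ℂ) : PowerSeries.constantCoeff (lin c) = 1 := by
  simp [lin]

@[simp]
theorem constantCoeff_prod_lin {ι : Type*} (s : Finset ι) (f : ι → ℂ) :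
    PowerSeries.constantCoeff (∏ i ∈ s, lin (f i)) = 1 := by
  simp [map_prod]

theorem prod_lin_mul_inv {ι : Type*} (s : Finset ι) (f : ι → ℂ) :
    (∏ i ∈ s, lin (f i)) * (∏ i ∈ s, lin (f i))⁻¹ = 1 :=
  PowerSeries.mul_inv_cancel _ (by simp)

/-! ### Expansions in inverse factorial powers. -/

theorem invFactorial_eq (a : ℤ → ℂ) (k : ℕ) :
    invFactorial a k =
      PowerSeries.X ^ k * (∏ i ∈ Finset.range k, lin (a (i + 1)))⁻¹ := rfl

/-- The denominator cancels, leaving t^j times a polynomial of degree at most k-1-j. -/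
theorem coeff_invFactorial_mul_prod (a : ℤ → ℂ) {j k : ℕ} (hjk : j < k) :
    PowerSeries.coeff k
      (invFactorial a j * ∏ i ∈ Finset.range (k - 1), lin (a (i + 1))) = 0 := by
  rw [invFactorial_eq, ← Finset.prod_range_mul_prod_Ico _ (show j ≤ k - 1 by omega)]
  have e : PowerSeries.X ^ j * (∏ i ∈ Finset.range j, lin (a (i + 1)))⁻¹ *
      ((∏ i ∈ Finset.range j, lin (a (i + 1))) * ∏ i ∈ Finset.Ico j (k - 1), lin (a (i + 1))) =
      PowerSeries.X ^ j *
        ((∏ i ∈ Finset.Ico j (k - 1), linPoly (a (i + 1)) : Polynomial ℂ) : ℂ⟦X⟧) := by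
    rw [coe_prod_linPoly]
    linear_combination (PowerSeries.X ^ j * ∏ i ∈ Finset.Ico j (k - 1), lin (a (i + 1))) *
      prod_lin_mul_inv (Finset.range j) (fun i => a (i + 1))
  rw [e, PowerSeries.coeff_X_pow_mul', if_pos hjk.le, Polynomial.coeff_coe]
  apply Polynomial.coeff_eq_zero_of_natDegree_lt
  have := natDegree_prod_linPoly_le (Finset.Ico j (k - 1)) (fun i => a (i + 1))
  rw [Nat.card_Ico] at this
  omega

/-- The coefficients of an expansion in the series `1 / ((u - a_1) ⋯ (u - a_k))`. -/
theorem eq_coeff_mul_prod_lin (a : ℤ → ℂ) (F : ℂ⟦X⟧) (h : ℕ → ℂ)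
    (H : ∀ n, ∑ k ∈ Finset.range (n + 1), PowerSeries.coeff n (invFactorial a k) * h k =
      PowerSeries.coeff n F) (k : ℕ) :
    h k = PowerSeries.coeff k (F * ∏ i ∈ Finset.range (k - 1), lin (a (i + 1))) := by
  -- Only terms up to `k` affect the coefficient; after multiplication by the product, those with `j
  -- < k` drop out.
  set G : ℂ⟦X⟧ := ∑ j ∈ Finset.range (k + 1), PowerSeries.C (h j) * invFactorial a j with hG
  have hFG : ∀ m ≤ k, PowerSeries.coeff m F = PowerSeries.coeff m G := by
    intro m hm
    rw [← H m, hG, map_sum]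
    simp only [PowerSeries.coeff_C_mul]
    rw [← Finset.sum_subset (Finset.range_mono (Nat.succ_le_succ hm))]
    · exact Finset.sum_congr rfl fun i _ => mul_comm _ _
    · intro x _ hx
      rw [coeff_invFactorial_of_lt a (by simpa using hx), mul_zero]
  have hc : PowerSeries.coeff k (F * ∏ i ∈ Finset.range (k - 1), lin (a (i + 1))) =
      PowerSeries.coeff k (G * ∏ i ∈ Finset.range (k - 1), lin (a (i + 1))) := by
    rw [PowerSeries.coeff_mul, PowerSeries.coeff_mul]
    refine Finset.sum_congr rfl fun p hp => ?_
    rw [hFG _ (by have := Finset.HasAntidiagonal.mem_antidiagonal.1 hp; omega)]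
  rw [hc, hG, Finset.sum_mul, map_sum, Finset.sum_eq_single k]
  · rw [mul_assoc, PowerSeries.coeff_C_mul, invFactorial_eq, mul_assoc,
      PowerSeries.coeff_X_pow_mul', if_pos le_rfl, Nat.sub_self,
      PowerSeries.coeff_zero_eq_constantCoeff_apply, map_mul, PowerSeries.constantCoeff_inv]
    simp
  · intro j hj hjk
    rw [Finset.mem_range] at hj
    rw [mul_assoc, PowerSeries.coeff_C_mul, coeff_invFactorial_mul_prod a (by omega), mul_zero]
  · simp

/-! ### The series H in the super realization. -/

/-- The image of `H` under the super realization. -/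
def superComplete (x y : ℕ →₀ ℂ) : ℂ⟦X⟧ :=
  PowerSeries.map (superEval x y : Sym →+* ℂ) completeSeries

theorem superEval_complete (x y : ℕ →₀ ℂ) (a : ℤ → ℂ) (k : ℕ) :
    superEval x y (complete a k) = PowerSeries.coeff k
      (superComplete x y * ∏ i ∈ Finset.range (k - 1), lin (a (i + 1))) := by
  refine eq_coeff_mul_prod_lin a _ (fun k => superEval x y (complete a k)) (fun n => ?_) k
  have h := congrArg (superEval x y) ((complete_iff a (complete a)).2 rfl n)
  simpa [superComplete, map_sum] using h

/-- The quotient f/g has derivative zero. This replaces taking logarithms of H. -/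
theorem eq_of_derivative_eq_mul {f g S : ℂ⟦X⟧}
    (hf : PowerSeries.derivative ℂ f = f * S) (hg : PowerSeries.derivative ℂ g = g * S)
    (hf1 : PowerSeries.constantCoeff f = 1) (hg1 : PowerSeries.constantCoeff g = 1) :
    f = g := by
  have hgi : g * g⁻¹ = 1 := PowerSeries.mul_inv_cancel _ (by simp [hg1])
  have h1 : f * g⁻¹ = 1 := by
    apply PowerSeries.derivative.ext
    · rw [Derivation.leibniz, PowerSeries.derivative_inv', hf, hg, PowerSeries.derivative_one]
      simp only [smul_eq_mul]
      linear_combination (-f * g⁻¹ * S) * hgi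
    · simp [PowerSeries.constantCoeff_inv, hf1, hg1]
  linear_combination g * h1 - f * hgi

theorem derivative_prod_lin (s : Finset ℕ) (f : ℕ → ℂ) :
    PowerSeries.derivative ℂ (∏ i ∈ s, lin (f i)) =
      (∏ i ∈ s, lin (f i)) * -(PowerSeries.mk fun n => ∑ i ∈ s, f i ^ (n + 1)) := by
  induction s using Finset.induction_on with
  | empty =>
    simp only [Finset.prod_empty, Finset.sum_empty, PowerSeries.derivative_one]
    ext n
    simp
  | insert i s hi ih =>
    have hm : lin (f i) * (PowerSeries.mk fun n => f i ^ (n + 1)) = PowerSeries.C (f i) := by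
      ext n
      rw [lin, sub_mul, one_mul, mul_assoc]
      cases n with
      | zero => simp
      | succ n => simp [PowerSeries.coeff_succ_X_mul]; ring
    have hd : PowerSeries.derivative ℂ (lin (f i)) = -PowerSeries.C (f i) := by
      simp [lin, Derivation.leibniz]
    have hs : (PowerSeries.mk fun n => ∑ j ∈ insert i s, f j ^ (n + 1)) =
        (PowerSeries.mk fun n => f i ^ (n + 1)) +
          PowerSeries.mk fun n => ∑ j ∈ s, f j ^ (n + 1) := by
      ext n
      simp [Finset.sum_insert hi]
    rw [Finset.prod_insert hi, Derivation.leibniz, ih, hd, hs]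
    simp only [smul_eq_mul]
    linear_combination (∏ j ∈ s, lin (f j)) * hm

theorem map_powerSumSeries_derivative (x y : ℕ →₀ ℂ) :
    PowerSeries.derivative ℂ (PowerSeries.map (superEval x y : Sym →+* ℂ) powerSumSeries) =
      PowerSeries.mk (superPowerSum x y) := by
  ext n
  rw [PowerSeries.coeff_derivative, PowerSeries.coeff_map, PowerSeries.coeff_mk, powerSumSeries,
    PowerSeries.coeff_mk]
  have : (n : ℂ) + 1 ≠ 0 := by exact_mod_cast n.succ_ne_zero
  simp [superEval]
  field_simp

theorem superComplete_eq_subst (x y : ℕ →₀ ℂ) :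
    superComplete x y = (PowerSeries.exp ℂ).subst
      (PowerSeries.map (superEval x y : Sym →+* ℂ) powerSumSeries) := by
  rw [superComplete, completeSeries]
  have h := PowerSeries.map_subst hasSubst_powerSumSeries (h := (superEval x y : Sym →+* ℂ))
    (PowerSeries.exp Sym)
  rw [PowerSeries.map_exp] at h
  exact h

theorem derivative_superComplete (x y : ℕ →₀ ℂ) :
    PowerSeries.derivative ℂ (superComplete x y) =
      superComplete x y * PowerSeries.mk (superPowerSum x y) := by
  have hs : PowerSeries.HasSubst
      (PowerSeries.map (superEval x y : Sym →+* ℂ) powerSumSeries) :=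
    PowerSeries.HasSubst.of_constantCoeff_zero' (by
      rw [← PowerSeries.coeff_zero_eq_constantCoeff_apply]
      simp [powerSumSeries])
  rw [superComplete_eq_subst, PowerSeries.derivative_subst hs, PowerSeries.derivative_exp,
    map_powerSumSeries_derivative]

theorem constantCoeff_superComplete (x y : ℕ →₀ ℂ) :
    PowerSeries.constantCoeff (superComplete x y) = 1 := by
  have h := superEval_complete x y 0 0
  simpa [complete_zero] using h.symm

/-- `H(u) = ∏ (u + y_i) / (u - x_i)` in the super realization. -/
theorem superComplete_mul_prod_lin (x y : ℕ →₀ ℂ) (s : Finset ℕ) (hx : x.support ⊆ s)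
    (hy : y.support ⊆ s) :
    superComplete x y * ∏ i ∈ s, lin (x i) = ∏ i ∈ s, lin (-y i) := by
  refine eq_of_derivative_eq_mul ?_ (derivative_prod_lin s fun i => -y i) ?_ (by simp)
  -- Since (-1)^k y^{k+1} = -(-y)^{k+1}, a super power sum is a difference of ordinary power sums in
  -- x and -y.
  · have hp : PowerSeries.mk (superPowerSum x y) =
        (PowerSeries.mk fun n => ∑ i ∈ s, x i ^ (n + 1)) -
          PowerSeries.mk fun n => ∑ i ∈ s, (-y i) ^ (n + 1) := by
      ext n
      simp only [PowerSeries.coeff_mk, map_sub, superPowerSum]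
      rw [Finsupp.sum_of_support_subset x hx _ (by simp),
        Finsupp.sum_of_support_subset y hy _ (by simp), Finset.mul_sum, sub_eq_add_neg,
        ← Finset.sum_neg_distrib]
      congr 1
      refine Finset.sum_congr rfl fun i _ => ?_
      rw [neg_pow (y i)]
      ring
    rw [Derivation.leibniz, derivative_superComplete, derivative_prod_lin, hp]
    simp only [smul_eq_mul]
    ring
  · simp [constantCoeff_superComplete]

/-! ### From Frobenius coordinates to rows. -/

theorem xSeq_apply (a : ℤ → ℂ) (lam : YoungDiagram) {i : ℕ} (hi : i < depth lam) :
    xSeq a lam i = a ((lam.rowLen i : ℤ) - i) := by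
  have h := YoungDiagram.mem_iff_lt_rowLen.1 ((lt_depth_iff lam i).1 hi)
  have e : ((frobeniusP lam i : ℤ) + 1) = (lam.rowLen i : ℤ) - i := by
    unfold frobeniusP; omega
  simp only [xSeq, Finsupp.onFinset_apply, if_pos hi, e]

theorem neg_ySeq_apply (a : ℤ → ℂ) (lam : YoungDiagram) {i : ℕ} (hi : i < depth lam) :
    -ySeq a lam i = a (-(frobeniusQ lam i : ℤ)) := by
  have e : (-((frobeniusQ lam i : ℤ) + 1) + 1) = -(frobeniusQ lam i : ℤ) := by ring
  simp only [ySeq, Finsupp.onFinset_apply, if_pos hi, dual, neg_neg, e]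

theorem depth_le_colLen (lam : YoungDiagram) : depth lam ≤ lam.colLen 0 := by
  by_contra! h
  have h1 := (lt_depth_iff lam _).1 h
  have h2 := YoungDiagram.mem_iff_lt_colLen.1 (lam.up_left_mem le_rfl (Nat.zero_le _) h1)
  omega

/-- The indices `Q_i` for `i < depth lam`, continued by `i - λ_i`. -/
def coFrobenius (lam : YoungDiagram) (i : ℕ) : ℕ :=
  if i < depth lam then frobeniusQ lam i else i - lam.rowLen i

theorem rowLen_le_of_depth_le {lam : YoungDiagram} {i : ℕ} (hi : depth lam ≤ i) :
    lam.rowLen i ≤ i := by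
  have h := (not_congr (lt_depth_iff lam i)).1 (not_lt.2 hi)
  rw [YoungDiagram.mem_iff_lt_rowLen] at h
  omega

theorem lt_colLen_of_lt_depth {lam : YoungDiagram} {i : ℕ} (hi : i < depth lam) :
    i < lam.colLen i :=
  YoungDiagram.mem_iff_lt_colLen.1 ((lt_depth_iff lam i).1 hi)

/-- In the mixed case equality would mean λ'_i + λ_j = i+j+1. But the sum is at least i+j+2 if (j,
i) ∈ λ, and at most i+j otherwise. -/
theorem coFrobenius_ne {lam : YoungDiagram} {i j : ℕ} (hij : i < j) :
    coFrobenius lam i ≠ coFrobenius lam j := by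
  unfold coFrobenius frobeniusQ
  have hr := lam.rowLen_anti i j hij.le
  have hc := lam.colLen_anti i j hij.le
  split_ifs with h1 h2 h2
  · have := lt_colLen_of_lt_depth h1
    have := lt_colLen_of_lt_depth h2
    omega
  · have h3 := lt_colLen_of_lt_depth h1
    have h4 := rowLen_le_of_depth_le (not_lt.1 h2)
    have h5 : i < lam.rowLen j ↔ j < lam.colLen i := by
      rw [← YoungDiagram.mem_iff_lt_rowLen, ← YoungDiagram.mem_iff_lt_colLen]
    omega
  · omega
  · have := rowLen_le_of_depth_le (not_lt.1 h1)
    have := rowLen_le_of_depth_le (not_lt.1 h2)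
    omega

theorem coFrobenius_lt {lam : YoungDiagram} {n i : ℕ} (hn : lam.colLen 0 ≤ n) (hi : i < n) :
    coFrobenius lam i < n := by
  have := lam.colLen_anti 0 i (Nat.zero_le _)
  unfold coFrobenius frobeniusQ
  split_ifs <;> omega

/-- `coFrobenius lam` permutes {0, …, n-1}, being an injective self-map. -/
theorem prod_coFrobenius {M : Type*} [CommMonoid M] (lam : YoungDiagram) {n : ℕ}
    (hn : lam.colLen 0 ≤ n) (f : ℕ → M) :
    ∏ i ∈ Finset.range n, f (coFrobenius lam i) = ∏ i ∈ Finset.range n, f i := by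
  have hmaps : Set.MapsTo (coFrobenius lam) (Finset.range n) (Finset.range n) := by
    intro i hi
    have hi' : i < n := by simpa using hi
    simpa using coFrobenius_lt hn hi'
  have hinj : Set.InjOn (coFrobenius lam) (Finset.range n) := by
    intro i _ j _ h
    by_contra hne
    rcases lt_or_gt_of_ne hne with h' | h'
    · exact coFrobenius_ne h' h
    · exact coFrobenius_ne h' h.symm
  exact Finset.prod_nbij (coFrobenius lam) (fun i hi => hmaps hi) hinj
    (Finset.surjOn_of_injOn_of_card_le _ hmaps hinj le_rfl) fun _ _ => rfl

/-- `H(x(λ); y(λ)) = ∏_{i ≤ n} (u - a_{1-i}) / (u - a_{λ_i - i + 1})` for `n ≥ ℓ(λ)`. -/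
theorem superComplete_mul_prod_rows (a : ℤ → ℂ) (lam : YoungDiagram) {n : ℕ}
    (hn : lam.colLen 0 ≤ n) :
    superComplete (xSeq a lam) (ySeq a lam) *
        ∏ i ∈ Finset.range n, lin (a ((lam.rowLen i : ℤ) - i)) =
      ∏ i ∈ Finset.range n, lin (a (-(i : ℤ))) := by
  have hD := (depth_le_colLen lam).trans hn
  have h := superComplete_mul_prod_lin (xSeq a lam) (ySeq a lam) (Finset.range (depth lam))
    Finsupp.support_onFinset_subset Finsupp.support_onFinset_subset
  rw [Finset.prod_congr rfl fun i hi => by rw [xSeq_apply a lam (Finset.mem_range.1 hi)],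
    Finset.prod_congr (f := fun i => lin (-ySeq a lam i))
      (g := fun i => lin (a (-(coFrobenius lam i : ℤ)))) rfl fun i hi => by
      rw [neg_ySeq_apply a lam (Finset.mem_range.1 hi), coFrobenius,
        if_pos (Finset.mem_range.1 hi)]] at h
  rw [← prod_coFrobenius lam hn (fun i => lin (a (-(i : ℤ)))),
    ← Finset.prod_range_mul_prod_Ico _ hD, ← Finset.prod_range_mul_prod_Ico _ hD, ← mul_assoc, h]
  -- Beyond the diagonal λ_i - i = -`coFrobenius lam i`, so both sides gain the same factors.
  congr 1
  refine Finset.prod_congr rfl fun i hi => ?_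
  have hi' := (Finset.mem_Ico.1 hi).1
  have := rowLen_le_of_depth_le hi'
  rw [coFrobenius, if_neg (not_lt.2 hi')]
  congr 2
  omega

/-! ### Row functionals and their dependence. -/

theorem reflect_X_sub_C_prod {ι : Type*} (s : Finset ι) (f : ι → ℂ) :
    Polynomial.reflect s.card (∏ i ∈ s, (Polynomial.X - Polynomial.C (f i))) =
      ∏ i ∈ s, linPoly (f i) := by
  classical
  induction s using Finset.induction_on with
  | empty => simp
  | insert i s hi ih =>
    rw [Finset.prod_insert hi, Finset.prod_insert hi, Finset.card_insert_of_notMem hi, add_comm,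
      Polynomial.reflect_mul _ _ (Polynomial.natDegree_X_sub_C_le _)
        (Polynomial.natDegree_finsetProd_X_sub_C_eq_card s f).le, ih]
    simp [linPoly]

theorem natDegree_reflect_le_of_le {n : ℕ} {p : Polynomial ℂ} (hp : p.natDegree ≤ n) :
    (p.reflect n).natDegree ≤ n := by
  simpa [hp] using Polynomial.natDegree_reflect_le (N := n) (p := p)

/-- The coefficient functional that represents the rows of the determinant. -/
def rowCoeff (b : ℕ → ℂ) (l : ℕ → ℕ) (n r : ℕ) (p : Polynomial ℂ) : ℂ :=
  PowerSeries.coeff r ((p.reflect (n - 1) : ℂ⟦X⟧) * (∏ s ∈ Finset.range r, lin (b s)) *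
    (∏ i ∈ Finset.range n, lin (b (l i)))⁻¹)

theorem rowCoeff_sum (b : ℕ → ℂ) (l : ℕ → ℕ) (n r : ℕ) (v : Fin n → ℂ)
    (p : Fin n → Polynomial ℂ) :
    rowCoeff b l n r (∑ j, Polynomial.C (v j) * p j) = ∑ j, v j * rowCoeff b l n r (p j) := by
  have h : Polynomial.reflect (n - 1) (∑ j, Polynomial.C (v j) * p j) =
      ∑ j, Polynomial.C (v j) * Polynomial.reflect (n - 1) (p j) := by
    ext i
    simp [Polynomial.coeff_reflect]
  unfold rowCoeff
  rw [h, ← Polynomial.coeToPowerSeries.ringHom_apply, map_sum, Finset.sum_mul, Finset.sum_mul,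
    map_sum]
  refine Finset.sum_congr rfl fun j _ => ?_
  rw [Polynomial.coeToPowerSeries.ringHom_apply, Polynomial.coe_mul, Polynomial.coe_C, mul_assoc,
    mul_assoc, PowerSeries.coeff_C_mul, ← mul_assoc]

/-- The given factor cancels the nodes before k, and ∏_{s<r} cancels the others, whose indices l_i
are distinct and below r. A polynomial of degree at most (n-1-k) + (r-(n-k)) = r-1 remains. -/
theorem rowCoeff_mul_eq_zero (b : ℕ → ℂ) (l : ℕ → ℕ) {n k r : ℕ} (hk : k < n)
    (hl : StrictAntiOn l (Set.Iio n)) (hr : l k < r) {q : Polynomial ℂ}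
    (hq : q.natDegree ≤ n - 1 - k) :
    rowCoeff b l n r
      ((∏ i ∈ Finset.range k, (Polynomial.X - Polynomial.C (b (l i)))) * q) = 0 := by
  have hdeg := (Polynomial.natDegree_finsetProd_X_sub_C_eq_card (Finset.range k)
    (fun i => b (l i))).le
  have hrefl := Polynomial.reflect_mul _ _ hdeg hq
  rw [reflect_X_sub_C_prod, Finset.card_range, show k + (n - 1 - k) = n - 1 by omega] at hrefl
  have hinj : Set.InjOn l (Finset.Ico k n : Finset ℕ) :=
    hl.injOn.mono fun i hi => (Finset.mem_Ico.1 hi).2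
  have hsub : (Finset.Ico k n).image l ⊆ Finset.range r := by
    intro m hm
    obtain ⟨i, hi, rfl⟩ := Finset.mem_image.1 hm
    rw [Finset.mem_Ico] at hi
    exact Finset.mem_range.2 ((hl.antitoneOn hk hi.2 hi.1).trans_lt hr)
  have hcard := Finset.card_sdiff_of_subset hsub
  rw [Finset.card_image_of_injOn hinj, Nat.card_Ico, Finset.card_range] at hcard
  have hle := Finset.card_le_card hsub
  rw [Finset.card_image_of_injOn hinj, Nat.card_Ico, Finset.card_range] at hle
  have hprod : (∏ s ∈ Finset.range r, lin (b s)) =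
      (∏ s ∈ Finset.range r \ (Finset.Ico k n).image l, lin (b s)) *
        ∏ i ∈ Finset.Ico k n, lin (b (l i)) := by
    rw [← Finset.prod_sdiff hsub, Finset.prod_image hinj]
  have e : ((((∏ i ∈ Finset.range k, (Polynomial.X - Polynomial.C (b (l i)))) * q).reflect (n - 1) :
      Polynomial ℂ) : ℂ⟦X⟧) * (∏ s ∈ Finset.range r, lin (b s)) *
        (∏ i ∈ Finset.range n, lin (b (l i)))⁻¹ =
      ((q.reflect (n - 1 - k) *
        ∏ s ∈ Finset.range r \ (Finset.Ico k n).image l, linPoly (b s) : Polynomial ℂ) :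
          ℂ⟦X⟧) := by
    have hinv := prod_lin_mul_inv (Finset.range n) (fun i => b (l i))
    rw [← Finset.prod_range_mul_prod_Ico _ hk.le] at hinv
    rw [hrefl, hprod, Polynomial.coe_mul, Polynomial.coe_mul, coe_prod_linPoly, coe_prod_linPoly,
      ← Finset.prod_range_mul_prod_Ico _ hk.le]
    linear_combination ((q.reflect (n - 1 - k) : ℂ⟦X⟧) *
      ∏ s ∈ Finset.range r \ (Finset.Ico k n).image l, lin (b s)) * hinv
  rw [rowCoeff, e, Polynomial.coeff_coe]
  apply Polynomial.coeff_eq_zero_of_natDegree_lt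
  refine Polynomial.natDegree_mul_le.trans_lt ?_
  have h1 := natDegree_reflect_le_of_le hq
  have h2 := natDegree_prod_linPoly_le (Finset.range r \ (Finset.Ico k n).image l) b
  omega

/-- Factorial Schur functions vanish: if the rows up to `k` have exponents above `l k`, then the
determinant of row coefficients of any polynomials of degree `< n` is zero. -/
theorem det_rowCoeff_eq_zero (b : ℕ → ℂ) (l r : ℕ → ℕ) {n k : ℕ} (hk : k < n)
    (hl : StrictAntiOn l (Set.Iio n)) (hr : ∀ i ≤ k, l k < r i) (p : Fin n → Polynomial ℂ)
    (hp : ∀ j, (p j).natDegree ≤ n - 1) :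
    (Matrix.of fun i j : Fin n => rowCoeff b l n (r i) (p j)).det = 0 := by
  set P : Polynomial ℂ := ∏ i ∈ Finset.range k, (Polynomial.X - Polynomial.C (b (l i))) with hP
  have hmonic : P.Monic := Polynomial.monic_prod_of_monic _ _ fun i _ => Polynomial.monic_X_sub_C _
  have hdeg : P.natDegree = k := by
    rw [hP, Polynomial.natDegree_finsetProd_X_sub_C_eq_card, Finset.card_range]
  -- A kernel vector of `M` gives a combination of the `p j` that is divisible by `P` (first k rows)
  -- and killed by the functionals after row k. Divisibility makes the functionals up to row k kill
  -- it too.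
  let M : Matrix (Fin n) (Fin n) ℂ := Matrix.of fun i j =>
    if (i : ℕ) < k then (p j %ₘ P).coeff i
    else if (i : ℕ) = k then 0 else rowCoeff b l n (r i) (p j)
  have hM : M.det = 0 :=
    Matrix.det_eq_zero_of_row_eq_zero ⟨k, hk⟩ fun j => by simp [M]
  obtain ⟨v, hv, hMv⟩ := Matrix.exists_mulVec_eq_zero_iff.2 hM
  refine Matrix.exists_mulVec_eq_zero_iff.1 ⟨v, hv, ?_⟩
  set p' : Polynomial ℂ := ∑ j, Polynomial.C (v j) * p j with hp'
  have hp'deg : p'.natDegree ≤ n - 1 :=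
    Polynomial.natDegree_sum_le_of_forall_le _ _ fun j _ =>
      (Polynomial.natDegree_C_mul_le _ _).trans (hp j)
  have hmod : p' %ₘ P = ∑ j, Polynomial.C (v j) * (p j %ₘ P) := by
    rw [hp', ← Polynomial.modByMonicHom_apply, map_sum]
    refine Finset.sum_congr rfl fun j _ => ?_
    rw [← Polynomial.smul_eq_C_mul, map_smul, Polynomial.smul_eq_C_mul,
      Polynomial.modByMonicHom_apply]
  have hmod0 : p' %ₘ P = 0 := by
    ext i
    by_cases hi : i < k
    · have h := congrFun hMv ⟨i, hi.trans hk⟩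
      simp only [Matrix.mulVec, dotProduct, M, Matrix.of_apply, if_pos hi, Pi.zero_apply] at h
      rw [hmod, Polynomial.finsetSum_coeff, Polynomial.coeff_zero, ← h]
      exact Finset.sum_congr rfl fun j _ => by rw [Polynomial.coeff_C_mul, mul_comm]
    · rw [Polynomial.coeff_zero]
      apply Polynomial.coeff_eq_zero_of_degree_lt
      refine (Polynomial.degree_modByMonic_lt _ hmonic).trans_le ?_
      rw [Polynomial.degree_eq_natDegree hmonic.ne_zero, hdeg]
      exact_mod_cast not_lt.1 hi
  have hfac : P * (p' /ₘ P) = p' := by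
    simpa [hmod0] using Polynomial.modByMonic_add_div p' P
  have hq : (p' /ₘ P).natDegree ≤ n - 1 - k := by
    rw [Polynomial.natDegree_divByMonic _ hmonic, hdeg]
    omega
  ext i
  have hrow : (Matrix.of fun i j : Fin n => rowCoeff b l n (r i) (p j)).mulVec v i =
      rowCoeff b l n (r i) p' := by
    rw [hp', rowCoeff_sum]
    simp [Matrix.mulVec, dotProduct, mul_comm]
  rw [Pi.zero_apply, hrow]
  by_cases hi : (i : ℕ) ≤ k
  · rw [← hfac]
    exact rowCoeff_mul_eq_zero b l hk hl (hr i hi) hq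
  · have h := congrFun hMv i
    simp only [Matrix.mulVec, dotProduct, M, Matrix.of_apply, Pi.zero_apply,
      if_neg (show ¬ (i : ℕ) < k by omega), if_neg (show ¬ (i : ℕ) = k by omega)] at h
    rw [hp', rowCoeff_sum, ← h]
    exact Finset.sum_congr rfl fun j _ => mul_comm _ _

/-! ### The determinant entries as row functionals. -/

theorem reflect_prod_Ico (b : ℕ → ℂ) {n j : ℕ} (hj : j < n) :
    ((∏ s ∈ Finset.Ico (n - j) n, (Polynomial.X - Polynomial.C (b s))).reflect (n - 1) : ℂ⟦X⟧) =
      PowerSeries.X ^ (n - 1 - j) * ∏ s ∈ Finset.Ico (n - j) n, lin (b s) := by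
  have hcard : (Finset.Ico (n - j) n).card = j := by rw [Nat.card_Ico]; omega
  have h := Polynomial.reflect_mul (∏ s ∈ Finset.Ico (n - j) n, (Polynomial.X - Polynomial.C (b s)))
    1 (Polynomial.natDegree_finsetProd_X_sub_C_eq_card _ _).le
    (Polynomial.natDegree_one.le.trans (Nat.zero_le (n - 1 - j)))
  rw [reflect_X_sub_C_prod, mul_one, hcard, show j + (n - 1 - j) = n - 1 by omega,
    Polynomial.reflect_one] at h
  rw [h, Polynomial.coe_mul, coe_prod_linPoly, Polynomial.coe_pow, Polynomial.coe_X, mul_comm]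

/-- The exponents `λ_i + n - 1 - i`, for rows numbered from `0`. -/
def rowExponent (lam : YoungDiagram) (n i : ℕ) : ℕ := lam.rowLen i + (n - 1 - i)

theorem strictAntiOn_rowExponent (lam : YoungDiagram) (n : ℕ) :
    StrictAntiOn (rowExponent lam n) (Set.Iio n) := by
  intro i hi j hj hij
  have := lam.rowLen_anti i j hij.le
  simp only [Set.mem_Iio] at hi hj
  unfold rowExponent
  omega

theorem inv_prod_rowExponent (a : ℤ → ℂ) (lam : YoungDiagram) {n : ℕ} (hn : lam.colLen 0 ≤ n) :
    (∏ i ∈ Finset.range n, lin (a ((rowExponent lam n i : ℤ) + 1 - n)))⁻¹ *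
        ∏ s ∈ Finset.range n, lin (a ((s : ℤ) + 1 - n)) =
      superComplete (xSeq a lam) (ySeq a lam) := by
  have h := superComplete_mul_prod_rows a lam hn
  rw [← Finset.prod_range_reflect (fun i => lin (a (-(i : ℤ)))),
    Finset.prod_congr (f := fun i => lin (a ((lam.rowLen i : ℤ) - i)))
      (g := fun i => lin (a ((rowExponent lam n i : ℤ) + 1 - n))) rfl fun i hi => by
      have := Finset.mem_range.1 hi
      unfold rowExponent
      congr 2
      omega,
    Finset.prod_congr (f := fun i => lin (a (-((n - 1 - i : ℕ) : ℤ))))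
      (g := fun s => lin (a ((s : ℤ) + 1 - n))) rfl fun i hi => by
      have := Finset.mem_range.1 hi
      congr 2
      omega] at h
  have hinv := prod_lin_mul_inv (Finset.range n)
    (fun i => a ((rowExponent lam n i : ℤ) + 1 - n))
  rw [← h]
  linear_combination superComplete (xSeq a lam) (ySeq a lam) * hinv

/-- For positive index, [n-j, n) and [0, r) together cover the same indices, with multiplicity, as
[0, n) and [n-j, r). The product over [0, n) is the numerator of H, the one over [n-j, r) is the
shifted product defining h. -/
theorem superEval_completeInt (a : ℤ → ℂ) (μ lam : YoungDiagram) {n i j : ℕ}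
    (hn : lam.colLen 0 ≤ n) (hi : i < n) (hj : j < n) :
    superEval (xSeq a lam) (ySeq a lam)
        (completeInt (shift (-(j : ℤ)) a) ((μ.rowLen i : ℤ) - (i : ℤ) + (j : ℤ))) =
      rowCoeff (fun s => a ((s : ℤ) + 1 - n)) (rowExponent lam n) n (rowExponent μ n i)
        (∏ s ∈ Finset.Ico (n - j) n,
          (Polynomial.X - Polynomial.C (a ((s : ℤ) + 1 - n)))) := by
  rw [rowCoeff, reflect_prod_Ico (fun s => a ((s : ℤ) + 1 - n)) hj, mul_assoc, mul_assoc,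
    PowerSeries.coeff_X_pow_mul']
  set b : ℕ → ℂ := fun s => a ((s : ℤ) + 1 - n) with hb
  by_cases hneg : μ.rowLen i + j < i
  · rw [completeInt, if_pos (by omega), map_zero, if_neg]
    unfold rowExponent
    omega
  obtain ⟨K, hK⟩ := Nat.exists_eq_add_of_le (not_lt.1 hneg)
  have hr : rowExponent μ n i = K + (n - 1 - j) := by
    unfold rowExponent
    omega
  rw [completeInt, if_neg (by omega), if_pos (by omega),
    show ((μ.rowLen i : ℤ) - (i : ℤ) + (j : ℤ)).toNat = K by omega,
    show rowExponent μ n i - (n - 1 - j) = K by omega, superEval_complete]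
  -- For `K = 0` the exponent is n-1-j < n-j, so the regrouping fails; both sides are 1.
  rcases Nat.eq_zero_or_pos K with rfl | hKpos
  · simp only [PowerSeries.coeff_zero_eq_constantCoeff_apply, map_mul,
      PowerSeries.constantCoeff_inv, constantCoeff_prod_lin, constantCoeff_superComplete]
    simp
  · congr 1
    have hshift : ∏ s ∈ Finset.range (K - 1), lin (shift (-(j : ℤ)) a (s + 1)) =
        ∏ s ∈ Finset.Ico (n - j) (rowExponent μ n i), lin (b s) := by
      rw [Finset.prod_Ico_eq_prod_range, show rowExponent μ n i - (n - j) = K - 1 by omega]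
      refine Finset.prod_congr rfl fun s _ => ?_
      rw [hb, shift]
      congr 2
      omega
    rw [hshift, ← inv_prod_rowExponent a lam hn,
      ← Finset.prod_range_mul_prod_Ico (fun s => lin (b s))
        (show n - j ≤ rowExponent μ n i by omega),
      ← Finset.prod_range_mul_prod_Ico (fun s : ℕ => lin (a ((s : ℤ) + 1 - n)))
        (Nat.sub_le n j)]
    ring

theorem superEval_schurDet (a : ℤ → ℂ) (μ lam : YoungDiagram) {n : ℕ} (hn : lam.colLen 0 ≤ n) :
    superEval (xSeq a lam) (ySeq a lam) (schurDet a μ n) =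
      (Matrix.of fun i j : Fin n =>
        rowCoeff (fun s => a ((s : ℤ) + 1 - n)) (rowExponent lam n) n (rowExponent μ n i)
          (∏ s ∈ Finset.Ico (n - (j : ℕ)) n,
            (Polynomial.X - Polynomial.C (a ((s : ℤ) + 1 - n))))).det := by
  rw [schurDet, AlgHom.map_det]
  congr 1
  ext i j
  exact superEval_completeInt a μ lam hn i.2 j.2

theorem exists_rowLen_lt {μ lam : YoungDiagram} (h : ¬ μ ≤ lam) :
    ∃ k < μ.colLen 0, lam.rowLen k < μ.rowLen k := by
  obtain ⟨⟨k, j⟩, hμ, hlam⟩ := Set.not_subset.1 (fun hs => h fun c hc => hs hc :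
    ¬ {c | c ∈ μ} ⊆ {c | c ∈ lam})
  refine ⟨k, YoungDiagram.mem_iff_lt_colLen.1 (μ.up_left_mem le_rfl (Nat.zero_le _) hμ), ?_⟩
  have h1 := YoungDiagram.mem_iff_lt_rowLen.1 hμ
  have h2 := (not_congr YoungDiagram.mem_iff_lt_rowLen).1 hlam
  omega

end MultiSchur

end

theorem theorem5p1 (a : ℤ → ℂ) (μ lam : YoungDiagram) (h : ¬ μ ≤ lam) :
    MultiSchur.superEval (MultiSchur.xSeq a lam) (MultiSchur.ySeq a lam)
      (MultiSchur.schur a μ) = 0 := by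
  obtain ⟨k, hkμ, hk⟩ := MultiSchur.exists_rowLen_lt h
  have hμ : μ.colLen 0 ≤ max (μ.colLen 0) (lam.colLen 0) := le_max_left _ _
  have hlam : lam.colLen 0 ≤ max (μ.colLen 0) (lam.colLen 0) := le_max_right _ _
  -- The determinant needs n ≥ ℓ(μ), the row formula for H needs n ≥ ℓ(λ).
  set n := max (μ.colLen 0) (lam.colLen 0)
  rw [← MultiSchur.schurDet_eq a μ hμ, MultiSchur.superEval_schurDet a μ lam hlam]
  refine MultiSchur.det_rowCoeff_eq_zero _ _ (MultiSchur.rowExponent μ n) (hkμ.trans_le hμ)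
    (MultiSchur.strictAntiOn_rowExponent lam n) (fun i hi => ?_) _ fun j => ?_
  · have := μ.rowLen_anti i k hi
    unfold MultiSchur.rowExponent
    omega
  · rw [Polynomial.natDegree_finsetProd_X_sub_C_eq_card, Nat.card_Ico]
    omega
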